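/- **Setting.** Let $A\in\mathbb R^{m\times n}$, $b\in\mathbb R^m$, $\Omega=\{x\in\mathbb R^n: Ax\le b\}\neq\emptyset$, and let $f:\mathbb R^n\to\mathbb R$ be continuously differentiable with gradient $g(x)$. $\|\cdot\|$ is the Euclidean norm and $P_S$ the Euclidean projection onto a closed convex set $S$. Put $\mathcal A(x)=\{i:(Ax-b)_i=0\}$, $\mathcal F(x)=\{i:(Ax-b)_i<0\}$, and $\Omega(x)=\{y\in\Omega:(Ay-b)_i=0\ \forall i\in\mathcal A(x)\}$. Let $g^{\mathcal A}(x)$ be the orthogonal projection of $g(x)$ onto $\{y:(Ay)_i=0\ \forall i\in\mathcal A(x)\}$, and let $$y(x,\alpha)=P_\Omega(x-\alpha g(x)),\quad d^\alpha(x)=y(x,\alpha)-x,\quad e(x)=\|g^{\mathcal A}(x)\|,\quad E(x)=\|d^1(x)\| .$$ For $x\in\Omega$ let $\lambda(x)$ be any vector with $y-x+g(x)+A^{\sf T}\lambda(x)=0$, $\lambda(x)\ge 0$, $\lambda_i(x)=0$ for $i\in\mathcal F(y)$, where $y=y(x,1)$. For fixed $\beta\in(1,2)$, $\gamma\in(0,1)$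 put $\mathcal U(x)=\{i:\lambda_i(x)\ge E(x)^\gamma\text{ and }(b-Ax)_i\ge E(x)^\beta\}$. **PASA (polyhedral active set algorithm).** Parameters: $\epsilon\in[0,\infty)$; $\delta,\eta,\theta,\mu\in(0,1)$; $\alpha\in(0,\infty)$; $\beta,\gamma$ as above. From $x_0\in\mathbb R^n$ set $x_1=P_\Omega(x_0)$, $k=1$, and start in phase one. The algorithm stops when $E(x_k)\le\epsilon$; otherwise it performs an iteration of the current phase. * *Phase one* (gradient projection). Let $d_k=d^\alpha(x_k)$, $x_{k+1}=x_k+s_kd_k$, where $s_k=\eta^j$ and $j\ge0$ is the smallest integer with $f(x_k+s_kd_k)\le f(x_k)+s_k\delta\, g(x_k)^{\sf T}d_k$. Then, if $\mathcal U(x_{k+1})=\emptyset$ and $e(x_{k+1})<\theta E(x_{k+1})$, replace $\theta$ by $\mu\theta$. Then go to phase two if $e(x_{k+1})\ge\theta E(x_{k+1})$ (with the current $\theta$); otherwise stay in phase one. * *Phase two*. $x_{k+1}$ is computed by a linearly constrained optimizer. Then go to phase one if $e(x_{k+1})<\theta E(x_{k+1})$; otherwise stay in phase two. The linearly constrained optimizer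 is arbitrary, subject to these requirements: * F1: its iterates lie in $\Omega$ and $f(x_{k+1})\le f(x_k)$. * F2: $\mathcal A(x_k)\subset\mathcal A(x_{k+1})$. * F3: if for some $k$ all iterations $j\ge k$ are in phase two and $\mathcal A(x_{j+1})=\mathcal A(x_j)$ for all $j\ge k$, then $\liminf_{j\to\infty}e(x_j)=0$. * F4: when phase one branches to phase two at $x_k$, the first iteration of phase two is $x_{k+1}=P_{\Omega(x_k)}(x_k-s_kg^{\mathcal A}(x_k))$, $s_k=\alpha\eta^j$, where $j\ge0$ is the smallest integer with $f(x_{k+1})\le f(x_k)+\delta\, g(x_k)^{\sf T}(x_{k+1}-x_k)$. **Lemma.** Let $x^*$ be a local minimizer of $f$ over $\Omega$ such that 1. $f$ is twice continuously differentiable in a neighborhood of $x^*$; 2. the rows of $A$ with index in $\mathcal A(x^*)$ are linearly independent; 3. the strong second-order sufficient optimality condition holds at $x^*$: there is $\sigma>0$ with $d^{\sf T}\nabla^2f(x^*)d\ge\sigma\|d\|^2$ for every $d\in\mathbb R^n$ with $(Ad)_i=0$ for all $i\in\mathcal A_+(x^*)$. Here $\mathcal A_+(x^*)=\{i\in\mathcal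 A(x^*):\lambda_i^*>0\}$, and $\lambda^*$ is the Lagrange multiplier at $x^*$, unique by 2: $g(x^*)+A^{\sf T}\lambda^*=0$, $\lambda^*\ge0$, $\lambda^*_i=0$ for $i\in\mathcal F(x^*)$. If PASA generates an infinite sequence of iterates $x_k$ converging to $x^*$, then there exists $\theta^*>0$ such that $e(x_k)\ge\theta^*E(x_k)$ for all sufficiently large $k$. -/

import Mathlib

open Filter Topology
open scoped Matrix

namespace PASA

variable {n m : ℕ}

/-! ### Euclidean projections -/

/-- `y` attains `min {‖x - z‖ : z ∈ S}`. -/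
def IsNearest (S : Set (EuclideanSpace ℝ (Fin n))) (x y : EuclideanSpace ℝ (Fin n)) : Prop :=
  y ∈ S ∧ ∀ z ∈ S, ‖x - y‖ ≤ ‖x - z‖

/-- The Euclidean projection `P_S(x) = arg min {‖x - y‖ : y ∈ S}`. It is used only for nonempty
closed convex `S`, where the minimizer exists and is unique
(see `isNearest_proj` and `IsNearest.eq_proj`). -/
noncomputable def proj (S : Set (EuclideanSpace ℝ (Fin n))) (x : EuclideanSpace ℝ (Fin n)) :
    EuclideanSpace ℝ (Fin n) :=
  Classical.epsilon (IsNearest S x)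

theorem isNearest_proj {S : Set (EuclideanSpace ℝ (Fin n))} (hne : S.Nonempty)
    (hcl : IsClosed S) (x : EuclideanSpace ℝ (Fin n)) : IsNearest S x (proj S x) := by
  obtain ⟨y, hy, hxy⟩ := hcl.exists_infDist_eq_dist hne x
  refine Classical.epsilon_spec (p := IsNearest S x) ⟨y, hy, fun z hz => ?_⟩
  rw [← dist_eq_norm, ← dist_eq_norm, ← hxy]
  exact Metric.infDist_le_dist_of_mem hz

theorem IsNearest.unique {S : Set (EuclideanSpace ℝ (Fin n))} (hc : Convex ℝ S)
    {x y z : EuclideanSpace ℝ (Fin n)} (hy : IsNearest S x y) (hz : IsNearest S x z) : y = z := by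
  have hmem : (1 / 2 : ℝ) • y + (1 / 2 : ℝ) • z ∈ S :=
    hc hy.1 hz.1 (by norm_num) (by norm_num) (by norm_num)
  have h1 := hy.2 _ hmem
  have h2 : ‖x - z‖ = ‖x - y‖ := le_antisymm (hz.2 _ hy.1) (hy.2 _ hz.1)
  have h3 := parallelogram_law_with_norm ℝ (x - y) (x - z)
  have h4 : (x - y) + (x - z) = (2 : ℝ) • (x - ((1 / 2 : ℝ) • y + (1 / 2 : ℝ) • z)) := by
    module
  have h5 : (x - y) - (x - z) = z - y := by abel
  rw [h4, h5, norm_smul, h2, Real.norm_eq_abs, abs_of_pos (by norm_num : (0 : ℝ) < 2)] at h3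
  have h6 : ‖z - y‖ = 0 := by
    nlinarith [norm_nonneg (z - y), norm_nonneg (x - y),
      norm_nonneg (x - ((1 / 2 : ℝ) • y + (1 / 2 : ℝ) • z))]
  exact (sub_eq_zero.mp (norm_eq_zero.mp h6)).symm

theorem IsNearest.eq_proj {S : Set (EuclideanSpace ℝ (Fin n))} (hcl : IsClosed S)
    (hc : Convex ℝ S) {x y : EuclideanSpace ℝ (Fin n)} (hy : IsNearest S x y) : y = proj S x :=
  hy.unique hc (isNearest_proj ⟨y, hy.1⟩ hcl x)

/-! ### The polyhedron, active sets, faces -/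

/-- The polyhedron `Ω = {x : A x ≤ b}`. -/
def polyhedron (A : Matrix (Fin m) (Fin n) ℝ) (b : Fin m → ℝ) :
    Set (EuclideanSpace ℝ (Fin n)) :=
  {x | ∀ i, (A *ᵥ x.ofLp) i ≤ b i}

/-- The active index set `{i : (A x - b)_i = 0}`. -/
def activeSet (A : Matrix (Fin m) (Fin n) ℝ) (b : Fin m → ℝ) (x : EuclideanSpace ℝ (Fin n)) :
    Set (Fin m) :=
  {i | (A *ᵥ x.ofLp) i - b i = 0}

/-- The free index set `{i : (A x - b)_i < 0}`. -/
def freeSet (A : Matrix (Fin m) (Fin n) ℝ) (b : Fin m → ℝ) (x : EuclideanSpace ℝ (Fin n)) :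
    Set (Fin m) :=
  {i | (A *ᵥ x.ofLp) i - b i < 0}

/-- The face of `Ω` on which every constraint active at `x` is active. -/
def face (A : Matrix (Fin m) (Fin n) ℝ) (b : Fin m → ℝ) (x : EuclideanSpace ℝ (Fin n)) :
    Set (EuclideanSpace ℝ (Fin n)) :=
  {y | y ∈ polyhedron A b ∧ ∀ i ∈ activeSet A b x, (A *ᵥ y.ofLp) i - b i = 0}

/-- The null space of the submatrix of `A` formed by the rows with index in `I`. -/
def nullSpace (A : Matrix (Fin m) (Fin n) ℝ) (I : Set (Fin m)) :
    Submodule ℝ (EuclideanSpace ℝ (Fin n)) where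
  carrier := {y | ∀ i ∈ I, (A *ᵥ y.ofLp) i = 0}
  add_mem' := by
    intro u v hu hv i hi
    simp [Matrix.mulVec_add, hu i hi, hv i hi]
  zero_mem' := by
    intro i _
    simp
  smul_mem' := by
    intro c u hu i hi
    simp [Matrix.mulVec_smul, hu i hi]

/-! ### Stationarity measures and multipliers -/

/-- `g^A(x)`: the orthogonal projection of the gradient `g(x)` onto the null space of the rows of
`A` that are active at `x`. -/
noncomputable def gradActive (A : Matrix (Fin m) (Fin n) ℝ) (b : Fin m → ℝ)
    (f : EuclideanSpace ℝ (Fin n) → ℝ) (x : EuclideanSpace ℝ (Fin n)) :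
    EuclideanSpace ℝ (Fin n) :=
  (nullSpace A (activeSet A b x)).starProjection (gradient f x)

/-- The local stationarity measure `e(x) = ‖g^A(x)‖`. -/
noncomputable def eLocal (A : Matrix (Fin m) (Fin n) ℝ) (b : Fin m → ℝ)
    (f : EuclideanSpace ℝ (Fin n) → ℝ) (x : EuclideanSpace ℝ (Fin n)) : ℝ :=
  ‖gradActive A b f x‖

/-- `y(x, α) = P_Ω(x - α g(x))`. -/
noncomputable def yStep (A : Matrix (Fin m) (Fin n) ℝ) (b : Fin m → ℝ)
    (f : EuclideanSpace ℝ (Fin n) → ℝ) (x : EuclideanSpace ℝ (Fin n)) (α : ℝ) :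
    EuclideanSpace ℝ (Fin n) :=
  proj (polyhedron A b) (x - α • gradient f x)

/-- `d^α(x) = y(x, α) - x`. -/
noncomputable def dStep (A : Matrix (Fin m) (Fin n) ℝ) (b : Fin m → ℝ)
    (f : EuclideanSpace ℝ (Fin n) → ℝ) (x : EuclideanSpace ℝ (Fin n)) (α : ℝ) :
    EuclideanSpace ℝ (Fin n) :=
  yStep A b f x α - x

/-- The global stationarity measure `E(x) = ‖d^1(x)‖`. -/
noncomputable def eGlobal (A : Matrix (Fin m) (Fin n) ℝ) (b : Fin m → ℝ)
    (f : EuclideanSpace ℝ (Fin n) → ℝ) (x : EuclideanSpace ℝ (Fin n)) : ℝ :=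
  ‖dStep A b f x 1‖

/-- The set `Λ(x, α)` of multipliers of the projection problem that defines `y = y(x, α)`:
`y - x + α g(x) + Aᵀ lam = 0`, `lam ≥ 0`, and `lam_i = 0` for `i` free at `y`. -/
def projMultipliers (A : Matrix (Fin m) (Fin n) ℝ) (b : Fin m → ℝ)
    (f : EuclideanSpace ℝ (Fin n) → ℝ) (x : EuclideanSpace ℝ (Fin n)) (α : ℝ) :
    Set (Fin m → ℝ) :=
  {lam | yStep A b f x α - x + α • gradient f x + WithLp.toLp 2 (Aᵀ *ᵥ lam) = 0 ∧
    (∀ i, 0 ≤ lam i) ∧ ∀ i ∈ freeSet A b (yStep A b f x α), lam i = 0}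

/-- The set `Λ(x)` of Lagrange multipliers at `x` of the problem `min {f(x) : A x ≤ b}`. -/
def multipliers (A : Matrix (Fin m) (Fin n) ℝ) (b : Fin m → ℝ)
    (f : EuclideanSpace ℝ (Fin n) → ℝ) (x : EuclideanSpace ℝ (Fin n)) : Set (Fin m → ℝ) :=
  {lam | gradient f x + WithLp.toLp 2 (Aᵀ *ᵥ lam) = 0 ∧
    (∀ i, 0 ≤ lam i) ∧ ∀ i ∈ freeSet A b x, lam i = 0}

/-- `A₊(x)`: the active constraints with a positive multiplier. It is used only where the active
constraint gradients are linearly independent, so that the multiplier is unique. -/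
def activePlus (A : Matrix (Fin m) (Fin n) ℝ) (b : Fin m → ℝ)
    (f : EuclideanSpace ℝ (Fin n) → ℝ) (x : EuclideanSpace ℝ (Fin n)) : Set (Fin m) :=
  {i | i ∈ activeSet A b x ∧ ∃ lam ∈ multipliers A b f x, 0 < lam i}

/-- The undecided index set at `x`, for the multiplier `lam ∈ Λ(x, 1)`. -/
def undecided (A : Matrix (Fin m) (Fin n) ℝ) (b : Fin m → ℝ)
    (f : EuclideanSpace ℝ (Fin n) → ℝ) (β γ : ℝ) (x : EuclideanSpace ℝ (Fin n))
    (lam : Fin m → ℝ) : Set (Fin m) :=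
  {i | eGlobal A b f x ^ γ ≤ lam i ∧ eGlobal A b f x ^ β ≤ b i - (A *ᵥ x.ofLp) i}

/-! ### Conditions on the limit point -/

/-- `x` is a local minimizer of `f` over `Ω`. -/
def IsLocalMinimizer (A : Matrix (Fin m) (Fin n) ℝ) (b : Fin m → ℝ)
    (f : EuclideanSpace ℝ (Fin n) → ℝ) (x : EuclideanSpace ℝ (Fin n)) : Prop :=
  x ∈ polyhedron A b ∧ IsLocalMinOn f (polyhedron A b) x

/-- The active constraint gradients (the active rows of `A`) are linearly independent at `x`. -/
def ActiveIndependent (A : Matrix (Fin m) (Fin n) ℝ) (b : Fin m → ℝ)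
    (x : EuclideanSpace ℝ (Fin n)) : Prop :=
  LinearIndependent ℝ (fun i : activeSet A b x => A i.1)

/-- The strong second-order sufficient optimality condition at `x`. The Hessian is the derivative
of the gradient. -/
def StrongSecondOrder (A : Matrix (Fin m) (Fin n) ℝ) (b : Fin m → ℝ)
    (f : EuclideanSpace ℝ (Fin n) → ℝ) (x : EuclideanSpace ℝ (Fin n)) : Prop :=
  ∃ σ : ℝ, 0 < σ ∧ ∀ d : EuclideanSpace ℝ (Fin n),
    (∀ i ∈ activePlus A b f x, (A *ᵥ d.ofLp) i = 0) →
      σ * ‖d‖ ^ 2 ≤ inner ℝ d (fderiv ℝ (gradient f) x d)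

/-! ### The polyhedral active set algorithm -/

/-- The parameters of the algorithm. -/
structure Params where
  δ : ℝ
  η : ℝ
  α : ℝ
  ε : ℝ
  θ : ℝ
  μ : ℝ
  β : ℝ
  γ : ℝ
  δ_mem : δ ∈ Set.Ioo (0 : ℝ) 1
  η_mem : η ∈ Set.Ioo (0 : ℝ) 1
  α_pos : 0 < α
  ε_nonneg : 0 ≤ ε
  θ_mem : θ ∈ Set.Ioo (0 : ℝ) 1
  μ_mem : μ ∈ Set.Ioo (0 : ℝ) 1
  β_mem : β ∈ Set.Ioo (1 : ℝ) 2
  γ_mem : γ ∈ Set.Ioo (0 : ℝ) 1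

/-- The Armijo condition of the gradient projection algorithm for the stepsize `s` at `x`. -/
def ArmijoGPA (A : Matrix (Fin m) (Fin n) ℝ) (b : Fin m → ℝ)
    (f : EuclideanSpace ℝ (Fin n) → ℝ) (p : Params) (x : EuclideanSpace ℝ (Fin n)) (s : ℝ) :
    Prop :=
  f (x + s • dStep A b f x p.α) ≤
    f x + s * p.δ * inner ℝ (gradient f x) (dStep A b f x p.α)

/-- One iteration `x → x'` of the gradient projection algorithm: `x' = x + η^j d^α(x)`, where
`j ≥ 0` is the smallest integer for which the Armijo condition holds. -/
def StepGPA (A : Matrix (Fin m) (Fin n) ℝ) (b : Fin m → ℝ)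
    (f : EuclideanSpace ℝ (Fin n) → ℝ) (p : Params) (x x' : EuclideanSpace ℝ (Fin n)) : Prop :=
  ∃ j : ℕ, ArmijoGPA A b f p x (p.η ^ j) ∧ (∀ i < j, ¬ ArmijoGPA A b f p x (p.η ^ i)) ∧
    x' = x + p.η ^ j • dStep A b f x p.α

/-- The trial point of the line search that starts phase two: the projection of
`x - s g^A(x)` onto the face of `x`. -/
noncomputable def faceTrial (A : Matrix (Fin m) (Fin n) ℝ) (b : Fin m → ℝ)
    (f : EuclideanSpace ℝ (Fin n) → ℝ) (x : EuclideanSpace ℝ (Fin n)) (s : ℝ) :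
    EuclideanSpace ℝ (Fin n) :=
  proj (face A b x) (x - s • gradActive A b f x)

/-- The Armijo condition of the line search that starts phase two. -/
def ArmijoFace (A : Matrix (Fin m) (Fin n) ℝ) (b : Fin m → ℝ)
    (f : EuclideanSpace ℝ (Fin n) → ℝ) (p : Params) (x : EuclideanSpace ℝ (Fin n)) (s : ℝ) :
    Prop :=
  f (faceTrial A b f x s) ≤
    f x + p.δ * inner ℝ (gradient f x) (faceTrial A b f x s - x)

/-- The first iteration `x → x'` of phase two (requirement F4): the stepsize is `α η^j`, where
`j ≥ 0` is the smallest integer for which the Armijo condition holds. -/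
def StepFirstLCO (A : Matrix (Fin m) (Fin n) ℝ) (b : Fin m → ℝ)
    (f : EuclideanSpace ℝ (Fin n) → ℝ) (p : Params) (x x' : EuclideanSpace ℝ (Fin n)) : Prop :=
  ∃ j : ℕ, ArmijoFace A b f p x (p.α * p.η ^ j) ∧
    (∀ i < j, ¬ ArmijoFace A b f p x (p.α * p.η ^ i)) ∧
    x' = faceTrial A b f x (p.α * p.η ^ j)

/-- The two phases: `one` is the gradient projection algorithm (GPA), `two` is the linearly
constrained optimizer (LCO). -/
inductive Phase
  | one
  | two

open Classical in
/-- The value of the branching parameter after a phase one iteration that produced `x`, with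
`lam` the multiplier that is used in the undecided index set. -/
noncomputable def nextTheta (A : Matrix (Fin m) (Fin n) ℝ) (b : Fin m → ℝ)
    (f : EuclideanSpace ℝ (Fin n) → ℝ) (p : Params) (x : EuclideanSpace ℝ (Fin n))
    (lam : Fin m → ℝ) (θ : ℝ) : ℝ :=
  if undecided A b f p.β p.γ x lam = ∅ ∧ eLocal A b f x < θ * eGlobal A b f x then p.μ * θ else θ

/-- An infinite run of the algorithm. The starting point is `x 0` and the iterates are
`x 1, x 2, …`; `phase k` is the phase in which `x (k + 1)` is computed from `x k`, `theta k` is the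
value of the branching parameter at that time, and `lam k ∈ Λ(x k, 1)` is the multiplier used in
the undecided index set at `x k` (any choice is allowed). The linearly constrained optimizer of
phase two is arbitrary, subject to F1 - F4. -/
structure IsRun (A : Matrix (Fin m) (Fin n) ℝ) (b : Fin m → ℝ)
    (f : EuclideanSpace ℝ (Fin n) → ℝ) (p : Params) (x : ℕ → EuclideanSpace ℝ (Fin n))
    (phase : ℕ → Phase) (theta : ℕ → ℝ) (lam : ℕ → Fin m → ℝ) : Prop where
  /-- initialization -/
  init : x 1 = proj (polyhedron A b) (x 0)
  init_phase : phase 1 = Phase.one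
  init_theta : theta 1 = p.θ
  /-- the stopping test always fails -/
  not_stop : ∀ k ≥ 1, p.ε < eGlobal A b f (x k)
  lam_mem : ∀ k ≥ 1, lam k ∈ projMultipliers A b f (x k) 1
  /-- phase one: a GPA iteration, then the update of the branching parameter, then branching -/
  one_step : ∀ k ≥ 1, phase k = Phase.one → StepGPA A b f p (x k) (x (k + 1))
  one_theta : ∀ k ≥ 1, phase k = Phase.one →
    theta (k + 1) = nextTheta A b f p (x (k + 1)) (lam (k + 1)) (theta k)
  one_branch : ∀ k ≥ 1, phase k = Phase.one →
    (phase (k + 1) = Phase.two ↔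
      theta (k + 1) * eGlobal A b f (x (k + 1)) ≤ eLocal A b f (x (k + 1)))
  /-- phase two: the branching parameter is kept, and branching -/
  two_theta : ∀ k ≥ 1, phase k = Phase.two → theta (k + 1) = theta k
  two_branch : ∀ k ≥ 1, phase k = Phase.two →
    (phase (k + 1) = Phase.one ↔
      eLocal A b f (x (k + 1)) < theta (k + 1) * eGlobal A b f (x (k + 1)))
  /-- F1: phase two is feasible and monotone -/
  f1 : ∀ k ≥ 1, phase k = Phase.two → x (k + 1) ∈ polyhedron A b ∧ f (x (k + 1)) ≤ f (x k)
  /-- F2: active sets do not shrink in phase two -/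
  f2 : ∀ k ≥ 1, phase k = Phase.two → activeSet A b (x k) ⊆ activeSet A b (x (k + 1))
  /-- F3: if from some point on only phase two is performed and the active set is constant, then
  `liminf e(x_j) = 0`, that is, the nonnegative numbers `e(x_j)` are infinitely often below any
  positive bound -/
  f3 : ∀ k ≥ 1,
    (∀ j ≥ k, phase j = Phase.two ∧ activeSet A b (x (j + 1)) = activeSet A b (x j)) →
      ∀ τ : ℝ, 0 < τ → ∃ᶠ j in atTop, eLocal A b f (x j) < τ
  /-- F4: the first iteration after branching from phase one to phase two -/
  f4 : ∀ k ≥ 1, phase k = Phase.one → phase (k + 1) = Phase.two →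
    StepFirstLCO A b f p (x (k + 1)) (x (k + 2))

/-- The algorithm with parameters `p` can generate the infinite sequence `x`. -/
def Generates (A : Matrix (Fin m) (Fin n) ℝ) (b : Fin m → ℝ)
    (f : EuclideanSpace ℝ (Fin n) → ℝ) (p : Params) (x : ℕ → EuclideanSpace ℝ (Fin n)) : Prop :=
  ∃ (phase : ℕ → Phase) (theta : ℕ → ℝ) (lam : ℕ → Fin m → ℝ), IsRun A b f p x phase theta lam

end PASA

namespace PASA

/-! ### Linear constraints -/

/-! Write `x*` for the limit, `g` for the gradient and `A₊` for the active constraints with positive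
multiplier at `x*`. Two facts combine.

Local estimate: let `y ∈ Ω` be near `x*` with `A₊ ⊆ A(y)`. Since `A(y) ⊆ A(x*)`, the vector `y - x*`
is annihilated by all rows active at `y`. The second-order condition and first-order optimality give
`c‖y - x*‖² ≤ ⟨g(y) - g(x*), y - x*⟩ ≤ ⟨g(y), y - x*⟩ ≤ e(y)‖y - x*‖`. Nonexpansiveness of the
projection gives `E(y) ≤ (2 + L)‖y - x*‖`. Hence `θ* = c / (2 + L)` works
(`exists_mul_eGlobal_le_eLocal`).

Identification: `A₊ ⊆ A(x_k)` eventually (`eventually_activePlus_subset`). Near `x*`, inactivity of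
some `i ∈ A₊` keeps `e` above a positive constant. This cannot persist: as `E → 0` and `θ ≤ 1`, the
run would stay in phase two, where active sets grow and stabilize, contradicting F3. So `i` is
active at some late iterate. It then stays active: by F2 in phase two, and in phase one because
`x_{k+1}` lies on the segment from `x_k` to a projected point where `i` is also active. -/

theorem continuous_mulVec_apply {n m : ℕ} (A : Matrix (Fin m) (Fin n) ℝ) (i : Fin m) :
    Continuous fun x : EuclideanSpace ℝ (Fin n) => (A *ᵥ x.ofLp) i := by
  unfold Matrix.mulVec dotProduct
  fun_prop

theorem convex_polyhedron {n m : ℕ} (A : Matrix (Fin m) (Fin n) ℝ) (b : Fin m → ℝ) :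
    Convex ℝ (polyhedron A b) := by
  intro u hu v hv s t hs ht hst i
  have hu' := mul_le_mul_of_nonneg_left (hu i) hs
  have hv' := mul_le_mul_of_nonneg_left (hv i) ht
  have hb : s * b i + t * b i = b i := by rw [← add_mul, hst, one_mul]
  simp only [WithLp.ofLp_add, WithLp.ofLp_smul, Matrix.mulVec_add, Matrix.mulVec_smul,
    Pi.add_apply, Pi.smul_apply, smul_eq_mul]
  linarith

theorem isClosed_polyhedron {n m : ℕ} (A : Matrix (Fin m) (Fin n) ℝ) (b : Fin m → ℝ) :
    IsClosed (polyhedron A b) := by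
  have h : polyhedron A b = ⋂ i, {x | (A *ᵥ x.ofLp) i ≤ b i} := by
    ext x
    simp [polyhedron]
  rw [h]
  exact isClosed_iInter fun i => isClosed_le (continuous_mulVec_apply A i) continuous_const

/-- Near a point of the polyhedron no further constraint becomes active. -/
theorem eventually_activeSet_subset {n m : ℕ} (A : Matrix (Fin m) (Fin n) ℝ) (b : Fin m → ℝ)
    (x : EuclideanSpace ℝ (Fin n)) : ∀ᶠ y in 𝓝 x, activeSet A b y ⊆ activeSet A b x := by
  have h : ∀ i, ∀ᶠ y in 𝓝 x, i ∈ activeSet A b y → i ∈ activeSet A b x := by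
    intro i
    by_cases hi : i ∈ activeSet A b x
    · exact Eventually.of_forall fun _ _ => hi
    · have hne : (A *ᵥ x.ofLp) i - b i ≠ 0 := hi
      filter_upwards [((continuous_mulVec_apply A i).sub continuous_const).continuousAt.eventually_ne
        hne] with y hy hy'
      exact absurd hy' hy
  filter_upwards [eventually_all.2 h] with y hy i hi using hy i hi

/-- Linearly independent active rows admit a direction that moves exactly one active
constraint. -/
theorem ActiveIndependent.exists_dual {n m : ℕ} {A : Matrix (Fin m) (Fin n) ℝ} {b : Fin m → ℝ}
    {x : EuclideanSpace ℝ (Fin n)} (h : ActiveIndependent A b x) {i : Fin m}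
    (hi : i ∈ activeSet A b x) :
    ∃ v : EuclideanSpace ℝ (Fin n), (A *ᵥ v.ofLp) i = 1 ∧
      ∀ j ∈ activeSet A b x, j ≠ i → (A *ᵥ v.ofLp) j = 0 := by
  -- Row `i` is outside the span of the other active rows, so some functional kills that span but
  -- not row `i`. Its representing vector, rescaled, is the direction.
  have hnot := LinearIndependent.notMem_span_image (s := {j | j ≠ ⟨i, hi⟩}) (x := ⟨i, hi⟩) h
    (by simp)
  obtain ⟨φ, hφ, hφ'⟩ := Submodule.exists_dual_map_eq_bot_of_notMem hnot inferInstance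
  obtain ⟨w, rfl⟩ := (dotProductEquiv ℝ (Fin n)).surjective φ
  simp only [dotProductEquiv_apply_apply] at hφ
  refine ⟨WithLp.toLp 2 ((w ⬝ᵥ A i)⁻¹ • w), ?_, fun j hj hji => ?_⟩
  · simp only [Matrix.mulVec, dotProduct_smul, smul_eq_mul]
    rw [dotProduct_comm (A i) w, inv_mul_cancel₀ hφ]
  · have hmem : dotProductEquiv ℝ (Fin n) w (A j) ∈ Submodule.map (dotProductEquiv ℝ (Fin n) w)
        (Submodule.span ℝ ((fun k : activeSet A b x => A k.1) '' {k | k ≠ ⟨i, hi⟩})) :=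
      Submodule.mem_map_of_mem (Submodule.subset_span ⟨⟨j, hj⟩, by simpa using hji, rfl⟩)
    rw [hφ', Submodule.mem_bot, dotProductEquiv_apply_apply] at hmem
    simp only [Matrix.mulVec, dotProduct_smul, smul_eq_mul]
    rw [dotProduct_comm (A j) w, hmem, mul_zero]

theorem inner_gradient_of_mem_multipliers {n m : ℕ} {A : Matrix (Fin m) (Fin n) ℝ}
    {b : Fin m → ℝ} {f : EuclideanSpace ℝ (Fin n) → ℝ} {x : EuclideanSpace ℝ (Fin n)}
    {lam : Fin m → ℝ} (h : lam ∈ multipliers A b f x) (v : EuclideanSpace ℝ (Fin n)) :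
    inner ℝ (gradient f x) v = -∑ j, lam j * (A *ᵥ v.ofLp) j := by
  rw [eq_neg_of_add_eq_zero_left h.1, inner_neg_left, EuclideanSpace.inner_eq_star_dotProduct,
    star_trivial, Matrix.mulVec_transpose, dotProduct_comm, ← Matrix.dotProduct_mulVec]
  rfl

/-- A positive multiplier is detected by a direction in which the gradient decreases. -/
theorem exists_direction_of_mem_activePlus {n m : ℕ} {A : Matrix (Fin m) (Fin n) ℝ}
    {b : Fin m → ℝ} {f : EuclideanSpace ℝ (Fin n) → ℝ} {x : EuclideanSpace ℝ (Fin n)}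
    (hx : x ∈ polyhedron A b) (hind : ActiveIndependent A b x) {i : Fin m}
    (hi : i ∈ activePlus A b f x) :
    ∃ v : EuclideanSpace ℝ (Fin n), inner ℝ (gradient f x) v < 0 ∧
      ∀ j ∈ activeSet A b x, j ≠ i → (A *ᵥ v.ofLp) j = 0 := by
  obtain ⟨hi, lam, hlam, hpos⟩ := hi
  obtain ⟨v, hv1, hv0⟩ := hind.exists_dual hi
  refine ⟨v, ?_, hv0⟩
  -- Only the term `i` survives: other active rows vanish on `v`, and inactive ones have zero
  -- multiplier.
  rw [inner_gradient_of_mem_multipliers hlam, Finset.sum_eq_single i]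
  · rw [hv1]
    linarith
  · intro j _ hji
    by_cases hj : j ∈ activeSet A b x
    · rw [hv0 j hj hji, mul_zero]
    · have hj' : (A *ᵥ x.ofLp) j - b j < 0 := lt_of_le_of_ne (sub_nonpos.2 (hx j)) hj
      rw [hlam.2.2 j hj', zero_mul]
  · simp

/-! ### Projections -/

theorem inner_proj_le_zero {n : ℕ} {S : Set (EuclideanSpace ℝ (Fin n))} (hne : S.Nonempty)
    (hcl : IsClosed S) (hc : Convex ℝ S) (x : EuclideanSpace ℝ (Fin n))
    {z : EuclideanSpace ℝ (Fin n)} (hz : z ∈ S) :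
    inner ℝ (x - proj S x) (z - proj S x) ≤ 0 := by
  have hp := isNearest_proj hne hcl x
  refine (norm_eq_iInf_iff_real_inner_le_zero hc hp.1).1 ?_ z hz
  have : Nonempty S := hne.to_subtype
  refine le_antisymm (le_ciInf fun w => hp.2 w w.2) ?_
  exact ciInf_le ⟨0, by rintro _ ⟨w, rfl⟩; exact norm_nonneg _⟩ (⟨_, hp.1⟩ : S)

/-- Add the variational inequalities of the two projections, each tested at the other, to get `‖u -
v‖² ≤ ⟨x - y, u - v⟩`; then apply Cauchy–Schwarz. -/
theorem norm_proj_sub_proj_le {n : ℕ} {S : Set (EuclideanSpace ℝ (Fin n))} (hne : S.Nonempty)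
    (hcl : IsClosed S) (hc : Convex ℝ S) (x y : EuclideanSpace ℝ (Fin n)) :
    ‖proj S x - proj S y‖ ≤ ‖x - y‖ := by
  have h1 := inner_proj_le_zero hne hcl hc x (isNearest_proj hne hcl y).1
  have h2 := inner_proj_le_zero hne hcl hc y (isNearest_proj hne hcl x).1
  set u := proj S x
  set v := proj S y
  have h3 : inner ℝ (x - y) (u - v) = ‖u - v‖ ^ 2 - inner ℝ (x - u) (v - u)
      - inner ℝ (y - v) (u - v) := by
    rw [← real_inner_self_eq_norm_sq]
    simp only [inner_sub_left, inner_sub_right]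
    ring
  have h4 := real_inner_le_norm (x - y) (u - v)
  rcases (norm_nonneg (u - v)).eq_or_lt with h0 | h0
  · rw [← h0]
    exact norm_nonneg _
  · refine le_of_mul_le_mul_right ?_ h0
    nlinarith

theorem eq_proj_of_inner_le_zero {n : ℕ} {S : Set (EuclideanSpace ℝ (Fin n))}
    (hcl : IsClosed S) (hc : Convex ℝ S) {x y : EuclideanSpace ℝ (Fin n)} (hy : y ∈ S)
    (h : ∀ z ∈ S, inner ℝ (x - y) (z - y) ≤ 0) : y = proj S x := by
  refine IsNearest.eq_proj hcl hc ⟨hy, fun z hz => ?_⟩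
  have : Nonempty S := ⟨⟨y, hy⟩⟩
  rw [(norm_eq_iInf_iff_real_inner_le_zero hc hy).2 h]
  exact ciInf_le ⟨0, by rintro _ ⟨w, rfl⟩; exact norm_nonneg _⟩ (⟨z, hz⟩ : S)

/-! ### Gradients and stationarity -/

theorem continuous_gradient {n : ℕ} {f : EuclideanSpace ℝ (Fin n) → ℝ} (hf : ContDiff ℝ 1 f) :
    Continuous (gradient f) :=
  (InnerProductSpace.toDual ℝ (EuclideanSpace ℝ (Fin n))).symm.continuous.comp
    (hf.continuous_fderiv one_ne_zero)

theorem differentiableAt_gradient {n : ℕ} {f : EuclideanSpace ℝ (Fin n) → ℝ}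
    {x : EuclideanSpace ℝ (Fin n)} (hf : ContDiffAt ℝ 2 f x) :
    DifferentiableAt ℝ (gradient f) x := by
  have h : DifferentiableAt ℝ (fderiv ℝ f) x :=
    (hf.fderiv_right (m := 1) (by norm_num)).differentiableAt one_ne_zero
  exact (InnerProductSpace.toDual ℝ
    (EuclideanSpace ℝ (Fin n))).symm.toContinuousLinearEquiv.differentiableAt.comp x h

theorem IsLocalMinimizer.inner_gradient_nonneg {n m : ℕ} {A : Matrix (Fin m) (Fin n) ℝ}
    {b : Fin m → ℝ} {f : EuclideanSpace ℝ (Fin n) → ℝ} {x : EuclideanSpace ℝ (Fin n)}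
    (h : IsLocalMinimizer A b f x) (hf : DifferentiableAt ℝ f x)
    {z : EuclideanSpace ℝ (Fin n)} (hz : z ∈ polyhedron A b) :
    0 ≤ inner ℝ (gradient f x) (z - x) := by
  have := h.2.hasFDerivWithinAt_nonneg hf.hasGradientAt.hasFDerivAt.hasFDerivWithinAt
    (sub_mem_posTangentConeAt_of_segment_subset ((convex_polyhedron A b).segment_subset h.1 hz))
  simpa using this

/-- The variational inequality characterizing the projection is here `α` times the first-order
condition. -/
theorem IsLocalMinimizer.yStep_eq {n m : ℕ} {A : Matrix (Fin m) (Fin n) ℝ}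
    {b : Fin m → ℝ} {f : EuclideanSpace ℝ (Fin n) → ℝ} {x : EuclideanSpace ℝ (Fin n)}
    (h : IsLocalMinimizer A b f x) (hf : DifferentiableAt ℝ f x) {α : ℝ} (hα : 0 ≤ α) :
    yStep A b f x α = x := by
  refine (eq_proj_of_inner_le_zero (isClosed_polyhedron A b) (convex_polyhedron A b) h.1
    fun z hz => ?_).symm
  have := mul_nonneg hα (h.inner_gradient_nonneg hf hz)
  rw [sub_sub_cancel_left, inner_neg_left, inner_smul_left]
  simpa using this

/-- `x` is a fixed point of the projected gradient map, and the projection is nonexpansive. -/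
theorem IsLocalMinimizer.norm_yStep_sub_le {n m : ℕ} {A : Matrix (Fin m) (Fin n) ℝ}
    {b : Fin m → ℝ} {f : EuclideanSpace ℝ (Fin n) → ℝ} {x : EuclideanSpace ℝ (Fin n)}
    (h : IsLocalMinimizer A b f x) (hf : DifferentiableAt ℝ f x) {α : ℝ} (hα : 0 ≤ α)
    (y : EuclideanSpace ℝ (Fin n)) :
    ‖yStep A b f y α - x‖ ≤ ‖y - x‖ + α * ‖gradient f y - gradient f x‖ := by
  conv_lhs => rw [← h.yStep_eq hf hα]
  refine (norm_proj_sub_proj_le ⟨x, h.1⟩ (isClosed_polyhedron A b) (convex_polyhedron A b)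
    _ _).trans ?_
  have h1 : y - α • gradient f y - (x - α • gradient f x)
      = (y - x) - α • (gradient f y - gradient f x) := by module
  rw [h1]
  refine (norm_sub_le _ _).trans ?_
  rw [norm_smul, Real.norm_of_nonneg hα]

theorem IsLocalMinimizer.tendsto_yStep {n m : ℕ} {A : Matrix (Fin m) (Fin n) ℝ}
    {b : Fin m → ℝ} {f : EuclideanSpace ℝ (Fin n) → ℝ} {x : EuclideanSpace ℝ (Fin n)}
    (h : IsLocalMinimizer A b f x) (hf : ContDiff ℝ 1 f) {α : ℝ} (hα : 0 ≤ α) :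
    Tendsto (fun y => yStep A b f y α) (𝓝 x) (𝓝 x) := by
  rw [tendsto_iff_norm_sub_tendsto_zero]
  refine squeeze_zero (fun _ => norm_nonneg _)
    (h.norm_yStep_sub_le (hf.differentiable one_ne_zero x) hα) ?_
  have hg := continuous_gradient hf
  have hc : Continuous fun y => ‖y - x‖ + α * ‖gradient f y - gradient f x‖ := by fun_prop
  simpa using hc.tendsto x

theorem IsLocalMinimizer.eGlobal_le {n m : ℕ} {A : Matrix (Fin m) (Fin n) ℝ}
    {b : Fin m → ℝ} {f : EuclideanSpace ℝ (Fin n) → ℝ} {x : EuclideanSpace ℝ (Fin n)}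
    (h : IsLocalMinimizer A b f x) (hf : DifferentiableAt ℝ f x)
    (y : EuclideanSpace ℝ (Fin n)) :
    eGlobal A b f y ≤ 2 * ‖y - x‖ + ‖gradient f y - gradient f x‖ := by
  have h1 := h.norm_yStep_sub_le hf zero_le_one y
  have h2 : dStep A b f y 1 = (yStep A b f y 1 - x) - (y - x) := by
    rw [dStep]
    abel
  have h3 := norm_sub_le (yStep A b f y 1 - x) (y - x)
  rw [eGlobal, h2]
  linarith

theorem IsLocalMinimizer.tendsto_eGlobal {n m : ℕ} {A : Matrix (Fin m) (Fin n) ℝ}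
    {b : Fin m → ℝ} {f : EuclideanSpace ℝ (Fin n) → ℝ} {x : EuclideanSpace ℝ (Fin n)}
    (h : IsLocalMinimizer A b f x) (hf : ContDiff ℝ 1 f) :
    Tendsto (eGlobal A b f) (𝓝 x) (𝓝 0) := by
  refine squeeze_zero (fun _ => norm_nonneg _)
    (h.eGlobal_le (hf.differentiable one_ne_zero x)) ?_
  have hg := continuous_gradient hf
  have hc : Continuous fun y => 2 * ‖y - x‖ + ‖gradient f y - gradient f x‖ := by fun_prop
  simpa using hc.tendsto x

/-- On the null space, `g` and its projection `g^A` have the same inner products. This is the source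
of every lower bound on `e`. -/
theorem abs_inner_gradient_le_eLocal {n m : ℕ} {A : Matrix (Fin m) (Fin n) ℝ}
    {b : Fin m → ℝ} {f : EuclideanSpace ℝ (Fin n) → ℝ} {x v : EuclideanSpace ℝ (Fin n)}
    (hv : v ∈ nullSpace A (activeSet A b x)) :
    |inner ℝ (gradient f x) v| ≤ eLocal A b f x * ‖v‖ := by
  have h : inner ℝ (gradient f x) v = inner ℝ (gradActive A b f x) v := by
    have := Submodule.starProjection_inner_eq_zero (gradient f x) v hv
    rwa [inner_sub_left, sub_eq_zero] at this
  rw [h]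
  exact abs_real_inner_le_norm _ _

/-- The second-order condition makes the gradient strongly monotone at `x`, on the null space of
the constraints with positive multiplier. -/
theorem StrongSecondOrder.eventually_le_inner {n m : ℕ} {A : Matrix (Fin m) (Fin n) ℝ}
    {b : Fin m → ℝ} {f : EuclideanSpace ℝ (Fin n) → ℝ} {x : EuclideanSpace ℝ (Fin n)}
    (h : StrongSecondOrder A b f x) (hf : DifferentiableAt ℝ (gradient f) x) :
    ∃ c : ℝ, 0 < c ∧ ∀ᶠ y in 𝓝 x, (∀ i ∈ activePlus A b f x, (A *ᵥ (y - x).ofLp) i = 0) →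
      c * ‖y - x‖ ^ 2 ≤ inner ℝ (gradient f y - gradient f x) (y - x) := by
  obtain ⟨σ, hσ, hσd⟩ := h
  refine ⟨σ / 2, half_pos hσ, ?_⟩
  -- The linearization error of the gradient is at most `σ / 2 * ‖y - x‖`, so half of the curvature
  -- `σ` survives.
  filter_upwards [(hasFDerivAt_iff_isLittleO.1 hf.hasFDerivAt).bound (half_pos hσ)] with y hy hA
  have h1 := hσd (y - x) hA
  have h2 := (abs_le.1 (abs_real_inner_le_norm (gradient f y - gradient f x
    - fderiv ℝ (gradient f) x (y - x)) (y - x))).1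
  have h3 := mul_le_mul_of_nonneg_right hy (norm_nonneg (y - x))
  rw [inner_sub_left] at h2
  rw [real_inner_comm] at h1
  nlinarith

/-- If all constraints with positive multiplier are active, then the local stationarity measure
dominates the global one. -/
theorem IsLocalMinimizer.exists_mul_eGlobal_le_eLocal {n m : ℕ} {A : Matrix (Fin m) (Fin n) ℝ}
    {b : Fin m → ℝ} {f : EuclideanSpace ℝ (Fin n) → ℝ} {x : EuclideanSpace ℝ (Fin n)}
    (h : IsLocalMinimizer A b f x) (hf : DifferentiableAt ℝ f x)
    (hg : DifferentiableAt ℝ (gradient f) x) (hsos : StrongSecondOrder A b f x) :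
    ∃ θ : ℝ, 0 < θ ∧ ∀ᶠ y in 𝓝 x, y ∈ polyhedron A b → activePlus A b f x ⊆ activeSet A b y →
      θ * eGlobal A b f y ≤ eLocal A b f y := by
  obtain ⟨c, hc, hmono⟩ := hsos.eventually_le_inner hg
  obtain ⟨L, hL, hlip⟩ := hg.isBigO_sub.exists_pos
  refine ⟨c / (2 + L), by positivity, ?_⟩
  filter_upwards [hmono, hlip.bound, eventually_activeSet_subset A b x] with y hy hyL hsub hyP hplus
  have hnull : ∀ i ∈ activeSet A b y, (A *ᵥ (y - x).ofLp) i = 0 := by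
    intro i hi
    have h1 : (A *ᵥ y.ofLp) i - b i = 0 := hi
    have h2 : (A *ᵥ x.ofLp) i - b i = 0 := hsub hi
    simp only [WithLp.ofLp_sub, Matrix.mulVec_sub, Pi.sub_apply]
    linarith
  have h1 := hy fun i hi => hnull i (hplus hi)
  have h2 := h.inner_gradient_nonneg hf hyP
  have h3 := (le_abs_self _).trans
    (abs_inner_gradient_le_eLocal (f := f) (x := y) (v := y - x) hnull)
  rw [inner_sub_left] at h1
  have h4 : c * ‖y - x‖ ≤ eLocal A b f y := by
    rcases (norm_nonneg (y - x)).eq_or_lt with h0 | h0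
    · rw [← h0, mul_zero]
      exact norm_nonneg _
    · refine le_of_mul_le_mul_right ?_ h0
      nlinarith
  have h5 : eGlobal A b f y ≤ (2 + L) * ‖y - x‖ := by
    have := h.eGlobal_le hf y
    linarith
  calc c / (2 + L) * eGlobal A b f y ≤ c / (2 + L) * ((2 + L) * ‖y - x‖) := by gcongr
    _ = c * ‖y - x‖ := by field_simp
    _ ≤ _ := h4

/-- Where a constraint with positive multiplier is inactive, the local stationarity measure is
bounded away from zero. -/
theorem exists_le_eLocal_of_notMem_activeSet {n m : ℕ} {A : Matrix (Fin m) (Fin n) ℝ}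
    {b : Fin m → ℝ} {f : EuclideanSpace ℝ (Fin n) → ℝ} {x : EuclideanSpace ℝ (Fin n)}
    (hf : ContDiff ℝ 1 f) (hx : x ∈ polyhedron A b) (hind : ActiveIndependent A b x) {i : Fin m}
    (hi : i ∈ activePlus A b f x) :
    ∃ c : ℝ, 0 < c ∧ ∀ᶠ y in 𝓝 x, i ∉ activeSet A b y → c ≤ eLocal A b f y := by
  obtain ⟨v, hv, hv0⟩ := exists_direction_of_mem_activePlus hx hind hi
  have hvne : 0 < ‖v‖ := norm_pos_iff.2 fun h0 => by simp [h0] at hv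
  set r := inner ℝ (gradient f x) v with hr
  refine ⟨-r / 2 / ‖v‖, by have := neg_pos.2 hv; positivity, ?_⟩
  have hcont : Continuous fun y => inner ℝ (gradient f y) v :=
    (continuous_gradient hf).inner continuous_const
  filter_upwards [eventually_activeSet_subset A b x,
    (hcont.tendsto x).eventually_lt_const (show r < r / 2 by linarith)] with y hsub hy hiy
  -- Among the constraints active at `x`, `v` can move only `i`, which is inactive at `y`.
  have hmem : v ∈ nullSpace A (activeSet A b y) := fun j hj =>
    hv0 j (hsub hj) fun h => hiy (h ▸ hj)
  have := (neg_le_abs _).trans (abs_inner_gradient_le_eLocal (f := f) hmem)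
  rw [div_le_iff₀ hvne]
  linarith

/-- Near `x`, the projected gradient point keeps the constraints with positive multiplier
active. -/
theorem IsLocalMinimizer.eventually_mem_activeSet_yStep {n m : ℕ}
    {A : Matrix (Fin m) (Fin n) ℝ} {b : Fin m → ℝ} {f : EuclideanSpace ℝ (Fin n) → ℝ}
    {x : EuclideanSpace ℝ (Fin n)} (h : IsLocalMinimizer A b f x) (hf : ContDiff ℝ 1 f)
    (hind : ActiveIndependent A b x) {α : ℝ} (hα : 0 < α) {i : Fin m}
    (hi : i ∈ activePlus A b f x) :
    ∀ᶠ y in 𝓝 x, i ∈ activeSet A b (yStep A b f y α) := by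
  obtain ⟨v, hv, hv0⟩ := exists_direction_of_mem_activePlus h.1 hind hi
  have hy := h.tendsto_yStep hf hα.le
  have hcl := isClosed_polyhedron A b
  have hlim : Tendsto (fun y => inner ℝ (y - α • gradient f y - yStep A b f y α) v) (𝓝 x)
      (𝓝 (inner ℝ (x - α • gradient f x - x) v)) :=
    ((tendsto_id.sub (((continuous_gradient hf).tendsto x).const_smul α)).sub hy).inner
      tendsto_const_nhds
  -- The limit equals `-α⟨g(x), v⟩`, so near `x` the projection residual has positive inner product
  -- with `v`.
  have hpos : 0 < inner ℝ (x - α • gradient f x - x) v := by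
    rw [sub_sub_cancel_left, inner_neg_left, real_inner_smul_left]
    nlinarith
  filter_upwards [hlim.eventually_const_lt hpos, hy (eventually_activeSet_subset A b x)]
    with y hyv hsub
  by_contra hiy
  have hyP : yStep A b f y α ∈ polyhedron A b := (isNearest_proj ⟨x, h.1⟩ hcl _).1
  -- If `i` were inactive at the projected point, `v` would preserve every constraint active there,
  -- so short steps along `v` stay feasible. Testing the projection inequality at such a step
  -- contradicts the sign of the residual.
  have hfeas : ∀ᶠ t : ℝ in 𝓝[>] 0, yStep A b f y α + t • v ∈ polyhedron A b := by
    refine eventually_all.2 fun j => ?_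
    by_cases hj : j ∈ activeSet A b (yStep A b f y α)
    · have hj0 := hv0 j (hsub hj) fun hji => hiy (hji ▸ hj)
      refine Eventually.of_forall fun t => ?_
      simpa [Matrix.mulVec_add, Matrix.mulVec_smul, hj0] using hyP j
    · have hlt : (A *ᵥ (yStep A b f y α + (0 : ℝ) • v).ofLp) j < b j := by
        rw [zero_smul, add_zero]
        exact sub_neg.1 (lt_of_le_of_ne (sub_nonpos.2 (hyP j)) hj)
      have hc : Continuous fun t : ℝ => (A *ᵥ (yStep A b f y α + t • v).ofLp) j :=
        (continuous_mulVec_apply A j).comp (by fun_prop)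
      filter_upwards [((hc.tendsto 0).eventually_lt_const hlt).filter_mono nhdsWithin_le_nhds]
        with t ht using ht.le
  obtain ⟨t, htP, ht⟩ := (hfeas.and self_mem_nhdsWithin).exists
  have hvi := inner_proj_le_zero ⟨x, h.1⟩ hcl (convex_polyhedron A b) (y - α • gradient f y) htP
  rw [show proj (polyhedron A b) (y - α • gradient f y) = yStep A b f y α from rfl,
    add_sub_cancel_left, real_inner_smul_right] at hvi
  exact absurd hvi (not_le.2 (mul_pos ht hyv))

/-! ### Runs of the algorithm -/

section Run

variable {n m : ℕ} {A : Matrix (Fin m) (Fin n) ℝ} {b : Fin m → ℝ}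
  {f : EuclideanSpace ℝ (Fin n) → ℝ} {p : Params} {x : ℕ → EuclideanSpace ℝ (Fin n)}
  {phase : ℕ → Phase} {theta : ℕ → ℝ} {lam : ℕ → Fin m → ℝ}

theorem IsRun.mem_polyhedron (hrun : IsRun A b f p x phase theta lam)
    (hne : (polyhedron A b).Nonempty) {k : ℕ} (hk : 1 ≤ k) : x k ∈ polyhedron A b := by
  have hcl := isClosed_polyhedron A b
  induction k, hk using Nat.le_induction with
  | base => exact hrun.init ▸ (isNearest_proj hne hcl _).1
  | succ k hk ih =>
    cases hph : phase k with
    | one =>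
      obtain ⟨j, -, -, hj⟩ := hrun.one_step k hk hph
      rw [hj]
      exact (convex_polyhedron A b).add_smul_sub_mem ih (isNearest_proj hne hcl _).1
        ⟨pow_nonneg p.η_mem.1.le _, pow_le_one₀ p.η_mem.1.le p.η_mem.2.le⟩
    | two => exact (hrun.f1 k hk hph).1

/-- The upper bound makes `E ≤ e` enough for the phase-two test, whatever the history of `θ`. -/
theorem IsRun.theta_le_one (hrun : IsRun A b f p x phase theta lam) {k : ℕ} (hk : 1 ≤ k) :
    0 ≤ theta k ∧ theta k ≤ 1 := by
  induction k, hk using Nat.le_induction with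
  | base => exact hrun.init_theta ▸ ⟨p.θ_mem.1.le, p.θ_mem.2.le⟩
  | succ k hk ih =>
    cases hph : phase k with
    | one =>
      rw [hrun.one_theta k hk hph, nextTheta]
      split_ifs
      · exact ⟨mul_nonneg p.μ_mem.1.le ih.1, mul_le_one₀ p.μ_mem.2.le ih.1 ih.2⟩
      · exact ih
    | two => exact hrun.two_theta k hk hph ▸ ih

/-- A constraint that is active at `x k` and at the projected gradient point remains active. -/
theorem IsRun.mem_activeSet_succ (hrun : IsRun A b f p x phase theta lam) {k : ℕ} (hk : 1 ≤ k)
    {i : Fin m} (hi : i ∈ activeSet A b (x k))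
    (hy : i ∈ activeSet A b (yStep A b f (x k) p.α)) : i ∈ activeSet A b (x (k + 1)) := by
  cases hph : phase k with
  | one =>
    obtain ⟨j, -, -, hj⟩ := hrun.one_step k hk hph
    have h1 : (A *ᵥ (x k).ofLp) i - b i = 0 := hi
    have h2 : (A *ᵥ (yStep A b f (x k) p.α).ofLp) i - b i = 0 := hy
    have h3 : (A *ᵥ (x (k + 1)).ofLp) i - b i = 0 := by
      rw [hj, dStep]
      simp only [WithLp.ofLp_add, WithLp.ofLp_smul, WithLp.ofLp_sub, Matrix.mulVec_add,
        Matrix.mulVec_smul, Matrix.mulVec_sub, Pi.add_apply, Pi.smul_apply, Pi.sub_apply,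
        smul_eq_mul]
      rw [sub_eq_zero.1 h1, sub_eq_zero.1 h2]
      ring
    exact h3
  | two => exact hrun.f2 k hk hph hi

/-- While `θ E ≤ e` holds, phase two is entered and not left. -/
theorem IsRun.phase_succ_eq_two (hrun : IsRun A b f p x phase theta lam) {k : ℕ} (hk : 1 ≤ k)
    (h : theta (k + 1) * eGlobal A b f (x (k + 1)) ≤ eLocal A b f (x (k + 1))) :
    phase (k + 1) = Phase.two := by
  cases hph : phase k with
  | one => exact (hrun.one_branch k hk hph).2 h
  | two =>
    cases hph' : phase (k + 1) with
    | one => exact absurd ((hrun.two_branch k hk hph).1 hph') (not_lt.2 h)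
    | two => rfl

/-- If the global stationarity measure tends to zero, then so does a subsequence of the local
one. -/
theorem IsRun.frequently_eLocal_lt (hrun : IsRun A b f p x phase theta lam)
    (hE : Tendsto (fun k => eGlobal A b f (x k)) atTop (𝓝 0)) {c : ℝ} (hc : 0 < c) :
    ∃ᶠ k in atTop, eLocal A b f (x k) < c := by
  by_contra hnot
  rw [not_frequently] at hnot
  obtain ⟨K, hK⟩ := eventually_atTop.1 (hnot.and (hE.eventually_lt_const hc))
  -- Starting at `K + 2` makes the predecessor index at least `1` even when `K = 0`; the run's rules
  -- hold only from index `1`.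
  have htwo : ∀ k ≥ K + 2, phase k = Phase.two := by
    intro k hk
    obtain ⟨j, rfl⟩ : ∃ j, k = j + 1 := ⟨k - 1, by omega⟩
    obtain ⟨h1, h2⟩ := hK (j + 1) (by omega)
    have hθ := hrun.theta_le_one (k := j + 1) (by omega)
    refine hrun.phase_succ_eq_two (by omega) ?_
    calc theta (j + 1) * eGlobal A b f (x (j + 1)) ≤ 1 * eGlobal A b f (x (j + 1)) :=
          mul_le_mul_of_nonneg_right hθ.2 (norm_nonneg _)
      _ ≤ _ := by rw [one_mul]; exact h2.le.trans (not_lt.1 h1)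
  have hmono : Monotone fun j => activeSet A b (x (K + 2 + j)) :=
    monotone_nat_of_le_succ fun j => hrun.f2 (K + 2 + j) (by omega) (htwo _ (by omega))
  -- An increasing chain of subsets of the finite set `Fin m` is eventually constant, so F3 applies
  -- and contradicts `hnot`.
  obtain ⟨N, hN⟩ := WellFoundedGT.monotone_chain_condition ⟨_, hmono⟩
  refine hrun.f3 (K + 2 + N) (by omega) (fun j hj => ⟨htwo j (by omega), ?_⟩) c hc hnot
  obtain ⟨l, rfl⟩ : ∃ l, j = K + 2 + l := ⟨j - (K + 2), by omega⟩
  exact (hN (l + 1) (by omega)).symm.trans (hN l (by omega))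

/-- The constraints with positive multiplier at the limit are eventually active. -/
theorem IsRun.eventually_activePlus_subset (hrun : IsRun A b f p x phase theta lam)
    (hf : ContDiff ℝ 1 f) {xstar : EuclideanSpace ℝ (Fin n)}
    (hmin : IsLocalMinimizer A b f xstar) (hind : ActiveIndependent A b xstar)
    (hlim : Tendsto x atTop (𝓝 xstar)) :
    ∀ᶠ k in atTop, activePlus A b f xstar ⊆ activeSet A b (x k) := by
  have h : ∀ i, ∀ᶠ k in atTop, i ∈ activePlus A b f xstar → i ∈ activeSet A b (x k) := by
    intro i
    by_cases hi : i ∈ activePlus A b f xstar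
    swap
    · exact Eventually.of_forall fun _ h => absurd h hi
    obtain ⟨c, hc, hce⟩ := exists_le_eLocal_of_notMem_activeSet hf hmin.1 hind hi
    obtain ⟨K, hK⟩ := eventually_atTop.1 ((hlim.eventually hce).and ((hlim.eventually
      (hmin.eventually_mem_activeSet_yStep hf hind p.α_pos hi)).and (eventually_ge_atTop 1)))
    -- One activation beyond `K` suffices, since from `K` on the projected points keep `i` active
    -- and activity is inherited inductively.
    obtain ⟨k, hkK, hk⟩ :=
      frequently_atTop.1 (hrun.frequently_eLocal_lt ((hmin.tendsto_eGlobal hf).comp hlim) hc) K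
    have hik : i ∈ activeSet A b (x k) := by
      by_contra hik
      exact absurd ((hK k hkK).1 hik) (not_le.2 hk)
    refine eventually_atTop.2 ⟨k, fun l hl _ => ?_⟩
    induction l, hl using Nat.le_induction with
    | base => exact hik
    | succ l hl ih =>
      obtain ⟨-, h2, h3⟩ := hK l (hkK.trans hl)
      exact hrun.mem_activeSet_succ h3 ih h2
  filter_upwards [eventually_all.2 h] with k hk i hi using hk i hi

end Run

end PASA

theorem lemma6p6 {n m : ℕ} (A : Matrix (Fin m) (Fin n) ℝ) (b : Fin m → ℝ)
    (f : EuclideanSpace ℝ (Fin n) → ℝ) (hf : ContDiff ℝ 1 f)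
    (xstar : EuclideanSpace ℝ (Fin n))
    (hf2 : ∃ r : ℝ, 0 < r ∧ ContDiffOn ℝ 2 f (Metric.ball xstar r))
    (hmin : PASA.IsLocalMinimizer A b f xstar)
    (hind : PASA.ActiveIndependent A b xstar)
    (hsos : PASA.StrongSecondOrder A b f xstar)
    (p : PASA.Params) (x : ℕ → EuclideanSpace ℝ (Fin n))
    (hrun : PASA.Generates A b f p x)
    (hlim : Tendsto x atTop (𝓝 xstar)) :
    ∃ θstar : ℝ, 0 < θstar ∧
      ∀ᶠ k in atTop, θstar * PASA.eGlobal A b f (x k) ≤ PASA.eLocal A b f (x k) := by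
  obtain ⟨r, hr, hf2⟩ := hf2
  obtain ⟨phase, theta, lam, hrun⟩ := hrun
  obtain ⟨θ, hθ, hev⟩ := hmin.exists_mul_eGlobal_le_eLocal (hf.differentiable one_ne_zero xstar)
    (PASA.differentiableAt_gradient (hf2.contDiffAt (Metric.ball_mem_nhds xstar hr))) hsos
  refine ⟨θ, hθ, ?_⟩
  filter_upwards [hlim.eventually hev, eventually_ge_atTop 1,
    hrun.eventually_activePlus_subset hf hmin hind hlim] with k h1 hk h2
  exact h1 (hrun.mem_polyhedron ⟨xstar, hmin.1⟩ hk) h2
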